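/- Fix a spacetime dimension $n$. Let $\mathsf{Loc}$ be the category whose objects are the nonempty globally hyperbolic spacetimes $M=(\mathcal M,g,\mathfrak o,\mathfrak t)$ of dimension $n$ with finitely many connected components (smooth Lorentzian metric of signature $+-\cdots-$, orientation $\mathfrak o$, time-orientation $\mathfrak t$) and whose morphisms are the smooth isometric embeddings that preserve orientation and time-orientation and have causally convex image. Let $\mathsf{Alg}$ be the category of nonzero unital complex $*$-algebras with unit-preserving injective $*$-homomorphisms. A locally covariant theory is a functor $\mathsf{Loc}\to\mathsf{Alg}$. For a theory $A$ and a nonempty open causally convex subset $O\subset M$ with finitely many connected components, let $M|_O$ be $O$ with the induced structures, let $\iota_{M;O}\colon M|_O\to M$ be the inclusion, and let $A^{\mathrm{kin}}(M;O)=A(\iota_{M;O})\big(A(M|_O)\big)\subset A(M)$ be the kinematic algebra of $O$. A morphism of $\mathsf{Loc}$ is Cauchy if its image contains a Cauchy surface of its target; $A$ has the timeslice property if $A(\psi)$ is an isomorphism for every Cauchy $\psi$. Let $H(M)$ be the set of smooth compactly supported rank-2 covariant tensor fields $h$ on $M$ such that $M[h]=(\mathcal M,g+h,\mathfrak o,\mathfrak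 t[h])$ is a globally hyperbolic spacetime, where $\mathfrak t[h]$ is the time-orientation that agrees with $\mathfrak t$ outside $\operatorname{supp}h$. For $h\in H(M)$ choose Cauchy morphisms $i^\pm\colon M^\pm\to M$ with images contained in $\mathcal M\setminus J_M^\mp(\operatorname{supp}h)$, and Cauchy morphisms $j^\pm\colon M^\pm\to M[h]$ with the same underlying maps as $i^\pm$. For a theory $A$ with the timeslice property, the relative Cauchy evolution is the automorphism $$\mathrm{rce}^{(A)}_M[h]=A(i^-)\circ A(j^-)^{-1}\circ A(j^+)\circ A(i^+)^{-1}$$ of $A(M)$. Proposition. Let $A,B\colon\mathsf{Loc}\to\mathsf{Alg}$ be locally covariant theories and let $\eta\colon A\Rightarrow B$ be a natural transformation (a subtheory embedding). (a) For every $M\in\mathsf{Loc}$ and every nonempty open causally convex $O\subset M$ with finitely many connected components, $$\eta_M\big(A^{\mathrm{kin}}(M;O)\big)\subset B^{\mathrm{kin}}(M;O),$$ with equality if $\eta$ is a natural isomorphism. (b) For every $M\in\mathsf{Loc}$ and every endomorphism $\psi\in\operatorname{End}(M)$, $\ \eta_M\circ A(\psi)=B(\psi)\circ\eta_M$. (c)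 If $A$ and $B$ have the timeslice property, then for every $M\in\mathsf{Loc}$ and every $h\in H(M)$, $$\eta_M\circ\mathrm{rce}^{(A)}_M[h]=\mathrm{rce}^{(B)}_M[h]\circ\eta_M,$$ for every choice of the Cauchy morphisms $i^\pm,j^\pm$ with which both relative Cauchy evolutions are computed. -/

import Mathlib

open Set Filter Topology CategoryTheory
open scoped Manifold ContDiff

universe u v

namespace LocCov

set_option linter.unusedSectionVars false

/-! ### Tensor fields, Lorentzian metrics, orientations -/

section Geometry

variable {n : ℕ}
  {M : Type*} [TopologicalSpace M] [ChartedSpace (EuclideanSpace ℝ (Fin n)) M]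
  [IsManifold (𝓡 n) ∞ M]
  {N : Type*} [TopologicalSpace N] [ChartedSpace (EuclideanSpace ℝ (Fin n)) N]
  [IsManifold (𝓡 n) ∞ N]
  {P : Type*} [TopologicalSpace P] [ChartedSpace (EuclideanSpace ℝ (Fin n)) P]
  [IsManifold (𝓡 n) ∞ P]

variable (n M) in
/-- (Not necessarily smooth) fields of covectors on an `n`-dimensional manifold. -/
abbrev OneForm := ∀ x : M, Module.Dual ℝ (TangentSpace (𝓡 n) x)

variable (n M) in
/-- (Not necessarily smooth) rank-2 covariant tensor fields. -/
abbrev Tensor2 := ∀ x : M, LinearMap.BilinForm ℝ (TangentSpace (𝓡 n) x)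

variable (n M) in
/-- (Not necessarily smooth) fields of alternating `n`-forms. -/
abbrev TopForm := ∀ x : M, (TangentSpace (𝓡 n) x) [⋀^Fin n]→ₗ[ℝ] ℝ

/-- A covariant tensor field of rank `k` (a map eating `k` tangent vectors at each point) is smooth
if its value on any `k` smooth vector fields on an open set is a smooth function on that set. -/
def SmoothTensor {k : ℕ} (T : ∀ x : M, (Fin k → TangentSpace (𝓡 n) x) → ℝ) : Prop :=
  ∀ (U : Set M), IsOpen U → ∀ X : Fin k → ∀ x : M, TangentSpace (𝓡 n) x,
    (∀ i, ContMDiffOn (𝓡 n) (𝓡 n).tangent ∞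
      (fun x => (⟨x, X i x⟩ : TangentBundle (𝓡 n) M)) U) →
    ContMDiffOn (𝓡 n) 𝓘(ℝ, ℝ) ∞ (fun x => T x (fun i => X i x)) U

def OneForm.Smooth (τ : OneForm n M) : Prop :=
  SmoothTensor (k := 1) (fun x w => τ x (w 0))

def Tensor2.Smooth (g : Tensor2 n M) : Prop :=
  SmoothTensor (k := 2) (fun x w => g x (w 0) (w 1))

def TopForm.Smooth (ν : TopForm n M) : Prop :=
  SmoothTensor (k := n) (fun x w => ν x w)

/-- Pullbacks along a map `ψ : M → N`. -/
noncomputable def OneForm.pullback (ψ : M → N) (τ : OneForm n N) : OneForm n M :=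
  fun x => (τ (ψ x)).comp (mfderiv (𝓡 n) (𝓡 n) ψ x).toLinearMap

noncomputable def Tensor2.pullback (ψ : M → N) (g : Tensor2 n N) : Tensor2 n M :=
  fun x => LinearMap.compl₁₂ (g (ψ x)) (mfderiv (𝓡 n) (𝓡 n) ψ x).toLinearMap
    (mfderiv (𝓡 n) (𝓡 n) ψ x).toLinearMap

noncomputable def TopForm.pullback (ψ : M → N) (ν : TopForm n N) : TopForm n M :=
  fun x => (ν (ψ x)).compLinearMap (mfderiv (𝓡 n) (𝓡 n) ψ x).toLinearMap

/-- Smooth Lorentzian metrics, with signature `(+,-,…,-)`. -/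
structure IsLorentzMetric (g : Tensor2 n M) : Prop where
  smooth : g.Smooth
  symm : ∀ x v w, g x v w = g x w v
  signature : ∀ x, ∃ v, 0 < g x v v ∧ ∀ w, g x v w = 0 → w ≠ 0 → g x w w < 0

/-- Nonzero causal (timelike or null) tangent vectors. -/
def IsCausalVector (g : Tensor2 n M) (x : M) (v : TangentSpace (𝓡 n) x) : Prop :=
  v ≠ 0 ∧ 0 ≤ g x v v

/-- The (nowhere zero) smooth `g`-timelike one-forms: at every point metrically dual to a timelike
vector. -/
def timelikeForms (g : Tensor2 n M) : Set (OneForm n M) :=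
  {τ | τ.Smooth ∧ ∀ x, ∃ w, 0 < g x w w ∧ ∀ v, τ x v = g x w v}

/-- A time orientation: a connected component of the set of smooth timelike one-forms. Two such
forms lie in the same component iff they are positive on the same causal vectors. -/
def IsTimeOrientation (g : Tensor2 n M) (t : Set (OneForm n M)) : Prop :=
  ∃ τ₀ ∈ timelikeForms g, t = {τ ∈ timelikeForms g |
    ∀ x v, IsCausalVector g x v → (0 < τ₀ x v ↔ 0 < τ x v)}

variable (n M) in
/-- The nowhere zero smooth `n`-forms. -/
def volumeForms : Set (TopForm n M) :=
  {ν | ν.Smooth ∧ ∀ x, ν x ≠ 0}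

/-- An orientation: a connected component of the set of nowhere zero smooth `n`-forms. Two such
forms lie in the same component iff they are positive on the same frames. -/
def IsOrientation (o : Set (TopForm n M)) : Prop :=
  ∃ ν₀ ∈ volumeForms n M, o = {ν ∈ volumeForms n M |
    ∀ x (e : Fin n → TangentSpace (𝓡 n) x), 0 < ν₀ x e ↔ 0 < ν x e}

variable (n M) in
/-- The data `(g, 𝔬, 𝔱)` of an oriented and time-oriented Lorentzian manifold. -/
structure LorentzStructure where
  metric : Tensor2 n M
  orientation : Set (TopForm n M)
  timeOrientation : Set (OneForm n M)
  isLorentzMetric : IsLorentzMetric metric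
  isOrientation : IsOrientation orientation
  isTimeOrientation : IsTimeOrientation metric timeOrientation

/-! ### Causal structure -/

/-- A smooth curve segment on `[a, b]` whose tangent vectors (one-sided at the ends) lie in a given
field of cones. -/
def IsSegment (C : ∀ x : M, Set (TangentSpace (𝓡 n) x)) (γ : ℝ → M) (a b : ℝ) : Prop :=
  a < b ∧ ContMDiffOn 𝓘(ℝ, ℝ) (𝓡 n) ∞ γ (Icc a b) ∧
    ∀ t ∈ Icc a b, mfderivWithin 𝓘(ℝ, ℝ) (𝓡 n) γ (Icc a b) t (1 : ℝ) ∈ C (γ t)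

/-- Piecewise smooth curves on an interval `I` with (one-sided) tangent vectors in a given
field of cones: to either side of each parameter value, the curve is locally a smooth segment, so
that the break points are locally finite. -/
def IsPiecewiseCurve (C : ∀ x : M, Set (TangentSpace (𝓡 n) x)) (γ : ℝ → M) (I : Set ℝ) : Prop :=
  ∀ t ∈ I, ((∃ s ∈ I, t < s) → ∃ s, Icc t s ⊆ I ∧ IsSegment C γ t s) ∧
    ((∃ s ∈ I, s < t) → ∃ s, Icc s t ⊆ I ∧ IsSegment C γ s t)

namespace LorentzStructure

variable (S : LorentzStructure n M)

/-- Future-directed causal vectors. -/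
def futureCausal (x : M) : Set (TangentSpace (𝓡 n) x) :=
  {v | IsCausalVector S.metric x v ∧ ∀ τ ∈ S.timeOrientation, 0 < τ x v}

/-- Future-directed timelike vectors. -/
def futureTimelike (x : M) : Set (TangentSpace (𝓡 n) x) :=
  {v | 0 < S.metric x v v ∧ ∀ τ ∈ S.timeOrientation, 0 < τ x v}

/-- `γ` restricted to `[a, b]` is a piecewise smooth future-directed causal curve. -/
def IsCausalCurve (γ : ℝ → M) (a b : ℝ) : Prop :=
  a < b ∧ IsPiecewiseCurve S.futureCausal γ (Icc a b)

/-- Causal future `J⁺(p)` of a point. -/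
def JPlus (p : M) : Set M :=
  {q | q = p ∨ ∃ γ a b, S.IsCausalCurve γ a b ∧ γ a = p ∧ γ b = q}

/-- Causal past `J⁻(p)` of a point. -/
def JMinus (p : M) : Set M := {q | p ∈ S.JPlus q}

/-- Causal future and past of a set. -/
def JPlusSet (K : Set M) : Set M := ⋃ p ∈ K, S.JPlus p

def JMinusSet (K : Set M) : Set M := ⋃ p ∈ K, S.JMinus p

/-- A set is causally convex if it contains every causal curve whose endpoints lie in it. -/
def CausallyConvex (O : Set M) : Prop :=
  ∀ γ a b, S.IsCausalCurve γ a b → γ a ∈ O → γ b ∈ O → ∀ t ∈ Icc a b, γ t ∈ O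

/-- Global hyperbolicity: there are no closed causal curves, and all sets `J⁺(p) ∩ J⁻(q)` are
compact. -/
def GloballyHyperbolic : Prop :=
  (∀ γ a b, S.IsCausalCurve γ a b → γ a ≠ γ b) ∧
    ∀ p q, IsCompact (S.JPlus p ∩ S.JMinus q)

/-- Inextendible timelike curves, parametrised by `ℝ` and future-directed (which is no
restriction): the curve has no future and no past endpoint. -/
def IsInextendibleTimelikeCurve (γ : ℝ → M) : Prop :=
  IsPiecewiseCurve S.futureTimelike γ univ ∧
    (¬ ∃ p, Tendsto γ atTop (𝓝 p)) ∧ ¬ ∃ p, Tendsto γ atBot (𝓝 p)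

/-- A Cauchy surface: a set met exactly once by every inextendible timelike curve. -/
def IsCauchySurface (A : Set M) : Prop :=
  ∀ γ, S.IsInextendibleTimelikeCurve γ → ∃! s, γ s ∈ A

end LorentzStructure

/-- Smooth isometric embeddings which preserve orientation and time-orientation and have causally
convex image. (Immersivity is implied by isometry.) -/
structure IsLocMorphism (S : LorentzStructure n M) (S' : LorentzStructure n N) (ψ : M → N) :
    Prop where
  contMDiff : ContMDiff (𝓡 n) (𝓡 n) ∞ ψ
  isEmbedding : IsEmbedding ψ
  isometric : S'.metric.pullback ψ = S.metric
  orientation : ∀ ν ∈ S'.orientation, TopForm.pullback ψ ν ∈ S.orientation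
  timeOrientation : ∀ τ ∈ S'.timeOrientation, OneForm.pullback ψ τ ∈ S.timeOrientation
  causallyConvex : S'.CausallyConvex (range ψ)

/-! ### Facts needed for composition and restriction -/

lemma pos_of_mem {S : LorentzStructure n M} {τ : OneForm n M} (hτ : τ ∈ S.timeOrientation)
    {x : M} {v : TangentSpace (𝓡 n) x} (hv : IsCausalVector S.metric x v) (h : 0 < τ x v) :
    ∀ τ' ∈ S.timeOrientation, 0 < τ' x v := by
  obtain ⟨τ₀, -, h₀⟩ := S.isTimeOrientation
  rw [h₀] at hτ ⊢
  intro τ' hτ'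
  exact (hτ'.2 x v hv).1 ((hτ.2 x v hv).2 h)

lemma LorentzStructure.timeOrientation_nonempty (S : LorentzStructure n M) :
    S.timeOrientation.Nonempty := by
  obtain ⟨τ₀, h, h₀⟩ := S.isTimeOrientation
  exact ⟨τ₀, h₀ ▸ ⟨h, fun _ _ _ => Iff.rfl⟩⟩

lemma IsLocMorphism.mfderiv_mem {S : LorentzStructure n M} {S' : LorentzStructure n N} {ψ : M → N}
    (h : IsLocMorphism S S' ψ) (x : M) (v : TangentSpace (𝓡 n) x) :
    mfderiv (𝓡 n) (𝓡 n) ψ x v ∈ S'.futureCausal (ψ x) ↔ v ∈ S.futureCausal x := by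
  have hg : S'.metric (ψ x) (mfderiv (𝓡 n) (𝓡 n) ψ x v) (mfderiv (𝓡 n) (𝓡 n) ψ x v)
      = S.metric x v v := by
    rw [← h.isometric]; rfl
  obtain ⟨τ, hτ⟩ := S'.timeOrientation_nonempty
  have hτ' := h.timeOrientation τ hτ
  have e : OneForm.pullback ψ τ x v = τ (ψ x) (mfderiv (𝓡 n) (𝓡 n) ψ x v) := rfl
  constructor
  · rintro ⟨⟨-, h2⟩, h3⟩
    have p := h3 τ hτ
    rw [← e] at p
    have hc : IsCausalVector S.metric x v := by
      refine ⟨fun h0 => ?_, hg ▸ h2⟩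
      rw [h0, map_zero] at p
      exact lt_irrefl _ p
    exact ⟨hc, pos_of_mem hτ' hc p⟩
  · rintro ⟨⟨-, h2⟩, h3⟩
    have p := h3 _ hτ'
    rw [e] at p
    have hc : IsCausalVector S'.metric (ψ x) (mfderiv (𝓡 n) (𝓡 n) ψ x v) := by
      refine ⟨fun h0 => ?_, hg ▸ h2⟩
      rw [h0, map_zero] at p
      exact lt_irrefl _ p
    exact ⟨hc, pos_of_mem hτ hc p⟩

lemma LorentzStructure.nondegenerate (S : LorentzStructure n M) (x : M)
    (v : TangentSpace (𝓡 n) x) (hv : ∀ w, S.metric x v w = 0) : v = 0 := by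
  by_contra h0
  obtain ⟨T, hT, hT'⟩ := S.isLorentzMetric.signature x
  have h1 := hT' v (by rw [S.isLorentzMetric.symm]; exact hv T) h0
  rw [hv v] at h1
  exact lt_irrefl _ h1

lemma mfderiv_injective_of_isometric {S : LorentzStructure n M} {g' : Tensor2 n N}
    {ψ : M → N} (h : g'.pullback ψ = S.metric) (x : M) :
    Function.Injective (mfderiv (𝓡 n) (𝓡 n) ψ x) := by
  rw [injective_iff_map_eq_zero]
  intro v hv
  apply S.nondegenerate
  intro w
  rw [← h]
  change g' (ψ x) (mfderiv (𝓡 n) (𝓡 n) ψ x v) (mfderiv (𝓡 n) (𝓡 n) ψ x w) = 0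
  rw [hv]; simp

/-- A smooth map with injective differential at a point has a smooth right inverse near the image
point (equal dimensions). -/
lemma exists_local_right_inverse {f : M → N} (hf : ContMDiff (𝓡 n) (𝓡 n) ∞ f) (x : M)
    (hx : Function.Injective (mfderiv (𝓡 n) (𝓡 n) f x)) :
    ∃ g : N → M, g (f x) = x ∧ ContMDiffAt (𝓡 n) (𝓡 n) ∞ g (f x) ∧
      ∀ᶠ y in 𝓝 (f x), f (g y) = y := by
  set F := writtenInExtChartAt (𝓡 n) (𝓡 n) x f with hF
  set φ := extChartAt (𝓡 n) x with hφ
  set ψ := extChartAt (𝓡 n) (f x) with hψ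
  have hFs : ContDiffAt ℝ ∞ F (φ x) := by
    have := (contMDiffAt_iff.1 (hf x)).2
    rw [(𝓡 n).range_eq_univ, contDiffWithinAt_univ] at this
    exact this
  have hmd : MDifferentiableAt (𝓡 n) (𝓡 n) f x := (hf x).mdifferentiableAt (by simp)
  obtain ⟨A, hA⟩ : ∃ A : EuclideanSpace ℝ (Fin n) →L[ℝ] EuclideanSpace ℝ (Fin n),
      A = mfderiv (𝓡 n) (𝓡 n) f x := ⟨_, rfl⟩
  have hAi : Function.Injective A := by subst hA; exact hx
  have hD : HasFDerivWithinAt F A (range (𝓡 n)) (φ x) := by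
    subst hA; exact hmd.hasMFDerivAt.2
  rw [(𝓡 n).range_eq_univ, hasFDerivWithinAt_univ] at hD
  let L : EuclideanSpace ℝ (Fin n) ≃L[ℝ] EuclideanSpace ℝ (Fin n) :=
    (LinearEquiv.ofInjectiveEndo A.toLinearMap hAi).toContinuousLinearEquiv
  have hL : (L : EuclideanSpace ℝ (Fin n) →L[ℝ] EuclideanSpace ℝ (Fin n)) = A := by
    ext1 v; rfl
  have hD' : HasFDerivAt F (L : EuclideanSpace ℝ (Fin n) →L[ℝ] EuclideanSpace ℝ (Fin n)) (φ x) := by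
    rw [hL]; exact hD
  have hFx : F (φ x) = ψ (f x) := by simp [hF, hφ, hψ, writtenInExtChartAt]
  have h0 : (∞ : ℕ∞ω) ≠ 0 := by simp
  set G := hFs.localInverse hD' h0 with hG
  have hGs : ContDiffAt ℝ ∞ G (ψ (f x)) := hFx ▸ hFs.to_localInverse hD' h0
  have hGx : G (ψ (f x)) = φ x := hFx ▸ hFs.localInverse_apply_image hD' h0
  have hGr : ∀ᶠ z in 𝓝 (ψ (f x)), F (G z) = z := by
    rw [← hFx]
    exact (hFs.hasStrictFDerivAt' hD' h0).eventually_right_inverse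
  have hψc : ContMDiffAt (𝓡 n) 𝓘(ℝ, EuclideanSpace ℝ (Fin n)) ∞ ψ (f x) := contMDiffAt_extChartAt
  have hφt : φ.target ∈ 𝓝 (φ x) := extChartAt_target_mem_nhds x
  have hφs : ContMDiffAt 𝓘(ℝ, EuclideanSpace ℝ (Fin n)) (𝓡 n) ∞ φ.symm (φ x) :=
    (contMDiffOn_extChartAt_symm x).contMDiffAt hφt
  have hGc : ContinuousAt (fun y => G (ψ y)) (f x) :=
    ContinuousAt.comp (f := ψ) (g := G) hGs.continuousAt hψc.continuousAt
  have hgs : ContMDiffAt (𝓡 n) (𝓡 n) ∞ (fun y => φ.symm (G (ψ y))) (f x) := by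
    have h1 : ContMDiffAt (𝓡 n) 𝓘(ℝ, EuclideanSpace ℝ (Fin n)) ∞ (fun y => G (ψ y)) (f x) :=
      ContMDiffAt.comp (f x) (g := G) (f := ψ) hGs.contMDiffAt hψc
    refine ContMDiffAt.comp (f x) (g := φ.symm) (f := fun y => G (ψ y)) ?_ h1
    rw [hGx]; exact hφs
  have hgx : φ.symm (G (ψ (f x))) = x := by
    rw [hGx]; exact extChartAt_to_inv x
  refine ⟨fun y => φ.symm (G (ψ y)), hgx, hgs, ?_⟩
  have hfg : ContinuousAt (fun y => f (φ.symm (G (ψ y)))) (f x) := by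
    refine ContinuousAt.comp (f := fun y => φ.symm (G (ψ y))) (g := f) ?_ hgs.continuousAt
    exact hf.continuous.continuousAt
  have e1 : ∀ᶠ y in 𝓝 (f x), f (φ.symm (G (ψ y))) ∈ ψ.source := by
    apply hfg.eventually_mem
    rw [hgx]
    exact extChartAt_source_mem_nhds _
  have e2 : ∀ᶠ y in 𝓝 (f x), y ∈ ψ.source := extChartAt_source_mem_nhds _
  have e3 : ∀ᶠ y in 𝓝 (f x), F (G (ψ y)) = ψ y := hψc.continuousAt.eventually hGr
  filter_upwards [e1, e2, e3] with y h1 h2 h3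
  have h3' : ψ (f (φ.symm (G (ψ y)))) = ψ y := h3
  exact ψ.injOn h1 h2 h3'

lemma mem_cone_congr {C : ∀ x : M, Set (TangentSpace (𝓡 n) x)} {y y' : M} (h : y = y')
    {w : EuclideanSpace ℝ (Fin n)} (hv : (show TangentSpace (𝓡 n) y from w) ∈ C y) :
    (show TangentSpace (𝓡 n) y' from w) ∈ C y' := by
  subst h; exact hv

lemma IsSegment.congr {C : ∀ x : M, Set (TangentSpace (𝓡 n) x)} {γ γ' : ℝ → M} {a b : ℝ}
    (h : IsSegment C γ a b) (e : EqOn γ γ' (Icc a b)) : IsSegment C γ' a b := by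
  refine ⟨h.1, h.2.1.congr fun t ht => (e ht).symm, fun t ht => ?_⟩
  have h1 := h.2.2 t ht
  have h2 : mfderivWithin 𝓘(ℝ, ℝ) (𝓡 n) γ' (Icc a b) t = mfderivWithin 𝓘(ℝ, ℝ) (𝓡 n) γ (Icc a b) t :=
    mfderivWithin_congr (fun s hs => (e hs).symm) (e ht).symm
  rw [h2]
  exact mem_cone_congr (e ht) h1

lemma uniqueMDiffWithinAt_Icc {a b t : ℝ} (hab : a < b) (ht : t ∈ Icc a b) :
    UniqueMDiffWithinAt 𝓘(ℝ, ℝ) (Icc a b) t :=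
  (uniqueDiffOn_Icc hab t ht).uniqueMDiffWithinAt

/-- Pushing segments forward along a smooth map. -/
lemma isSegment_comp_iff {C : ∀ x : M, Set (TangentSpace (𝓡 n) x)}
    {C' : ∀ x : N, Set (TangentSpace (𝓡 n) x)} {f : M → N} (hf : ContMDiff (𝓡 n) (𝓡 n) ∞ f)
    (hC : ∀ x v, mfderiv (𝓡 n) (𝓡 n) f x v ∈ C' (f x) ↔ v ∈ C x)
    {γ : ℝ → M} {a b : ℝ} (hγ : ContMDiffOn 𝓘(ℝ, ℝ) (𝓡 n) ∞ γ (Icc a b)) :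
    IsSegment C' (f ∘ γ) a b ↔ IsSegment C γ a b := by
  have key : ∀ t ∈ Icc a b, a < b → mfderivWithin 𝓘(ℝ, ℝ) (𝓡 n) (f ∘ γ) (Icc a b) t =
      (mfderiv (𝓡 n) (𝓡 n) f (γ t)).comp (mfderivWithin 𝓘(ℝ, ℝ) (𝓡 n) γ (Icc a b) t) := by
    intro t ht hab
    exact mfderiv_comp_mfderivWithin t ((hf _).mdifferentiableAt (by simp))
      ((hγ t ht).mdifferentiableWithinAt (by simp)) (uniqueMDiffWithinAt_Icc hab ht)
  constructor
  · rintro ⟨hab, -, h⟩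
    refine ⟨hab, hγ, fun t ht => ?_⟩
    have h1 := h t ht
    rw [key t ht hab] at h1
    exact (hC _ _).1 h1
  · rintro ⟨hab, -, h⟩
    refine ⟨hab, hf.comp_contMDiffOn hγ, fun t ht => ?_⟩
    rw [key t ht hab]
    exact (hC _ _).2 (h t ht)

/-- Curves in the image of an injective immersion (in equal dimensions) lift smoothly. -/
lemma contMDiffOn_lift {f : M → N} (hf : ContMDiff (𝓡 n) (𝓡 n) ∞ f) (hi : Function.Injective f)
    (hd : ∀ x, Function.Injective (mfderiv (𝓡 n) (𝓡 n) f x)) {δ : ℝ → M} {I : Set ℝ}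
    (hγ : ContMDiffOn 𝓘(ℝ, ℝ) (𝓡 n) ∞ (f ∘ δ) I) :
    ContMDiffOn 𝓘(ℝ, ℝ) (𝓡 n) ∞ δ I := by
  intro t ht
  obtain ⟨g, hg0, hg, hfg⟩ := exists_local_right_inverse hf (δ t) (hd _)
  have h1 : ContMDiffWithinAt 𝓘(ℝ, ℝ) (𝓡 n) ∞ (g ∘ (f ∘ δ)) I t :=
    ContMDiffAt.comp_contMDiffWithinAt (x := t) (g := g) (f := f ∘ δ) hg (hγ t ht)
  refine h1.congr_of_eventuallyEq ?_ hg0.symm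
  have h2 : ∀ᶠ s in 𝓝[I] t, f (g (f (δ s))) = f (δ s) :=
    (hγ t ht).continuousWithinAt.eventually hfg
  filter_upwards [h2] with s hs
  exact (hi hs).symm

/-- Piecewise curves in `M` correspond to piecewise curves in `N` inside the image. -/
lemma isPiecewiseCurve_comp_iff {C : ∀ x : M, Set (TangentSpace (𝓡 n) x)}
    {C' : ∀ x : N, Set (TangentSpace (𝓡 n) x)} {f : M → N} (hf : ContMDiff (𝓡 n) (𝓡 n) ∞ f)
    (hi : Function.Injective f) (hd : ∀ x, Function.Injective (mfderiv (𝓡 n) (𝓡 n) f x))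
    (hC : ∀ x v, mfderiv (𝓡 n) (𝓡 n) f x v ∈ C' (f x) ↔ v ∈ C x)
    {δ : ℝ → M} {I : Set ℝ} :
    IsPiecewiseCurve C' (f ∘ δ) I ↔ IsPiecewiseCurve C δ I := by
  have key : ∀ a b, IsSegment C' (f ∘ δ) a b ↔ IsSegment C δ a b := by
    intro a b
    constructor
    · intro h
      exact (isSegment_comp_iff hf hC (contMDiffOn_lift hf hi hd h.2.1)).1 h
    · intro h
      exact (isSegment_comp_iff hf hC h.2.1).2 h
  simp only [IsPiecewiseCurve, key]

lemma IsPiecewiseCurve.congr {C : ∀ x : M, Set (TangentSpace (𝓡 n) x)} {γ γ' : ℝ → M} {I : Set ℝ}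
    (h : IsPiecewiseCurve C γ I) (e : EqOn γ γ' I) : IsPiecewiseCurve C γ' I := by
  intro t ht
  refine ⟨fun hs => ?_, fun hs => ?_⟩
  · obtain ⟨s, h1, h2⟩ := (h t ht).1 hs
    exact ⟨s, h1, h2.congr (e.mono h1)⟩
  · obtain ⟨s, h1, h2⟩ := (h t ht).2 hs
    exact ⟨s, h1, h2.congr (e.mono h1)⟩

namespace IsLocMorphism

variable {S : LorentzStructure n M} {S' : LorentzStructure n N} {S'' : LorentzStructure n P}
  {ψ : M → N} {φ : N → P}

lemma mfderiv_injective (h : IsLocMorphism S S' ψ) (x : M) :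
    Function.Injective (mfderiv (𝓡 n) (𝓡 n) ψ x) :=
  mfderiv_injective_of_isometric h.isometric x

lemma isCausalCurve_comp_iff (h : IsLocMorphism S S' ψ) {δ : ℝ → M} {a b : ℝ} :
    S'.IsCausalCurve (ψ ∘ δ) a b ↔ S.IsCausalCurve δ a b :=
  and_congr_right fun _ => isPiecewiseCurve_comp_iff h.contMDiff h.isEmbedding.injective
    h.mfderiv_injective h.mfderiv_mem

lemma exists_lift (h : IsLocMorphism S S' ψ) {γ : ℝ → N} {a b : ℝ}
    (hγ : S'.IsCausalCurve γ a b) (hr : ∀ t ∈ Icc a b, γ t ∈ range ψ) :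
    ∃ δ, S.IsCausalCurve δ a b ∧ ∀ t ∈ Icc a b, ψ (δ t) = γ t := by
  obtain ⟨x₀, -⟩ := hr a (left_mem_Icc.2 hγ.1.le)
  have : Nonempty M := ⟨x₀⟩
  have e : ∀ t ∈ Icc a b, ψ (Function.invFun ψ (γ t)) = γ t := fun t ht =>
    Function.invFun_eq (hr t ht)
  refine ⟨fun t => Function.invFun ψ (γ t), ?_, e⟩
  rw [← h.isCausalCurve_comp_iff]
  exact ⟨hγ.1, hγ.2.congr fun t ht => (e t ht).symm⟩

protected lemma id : IsLocMorphism S S (id : M → M) where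
  contMDiff := contMDiff_id
  isEmbedding := .id
  isometric := by
    funext x; ext v w
    simp [Tensor2.pullback, mfderiv_id]
  orientation := by
    intro ν hν
    have : TopForm.pullback (id : M → M) ν = ν := by
      funext x; ext v
      simp only [TopForm.pullback, mfderiv_id]
      rfl
    rwa [this]
  timeOrientation := by
    intro τ hτ
    have : OneForm.pullback (id : M → M) τ = τ := by
      funext x; ext v
      simp only [OneForm.pullback, mfderiv_id]
      rfl
    rwa [this]
  causallyConvex := by simp [LorentzStructure.CausallyConvex]

protected lemma comp (h' : IsLocMorphism S' S'' φ) (h : IsLocMorphism S S' ψ) :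
    IsLocMorphism S S'' (φ ∘ ψ) := by
  have key : ∀ x, mfderiv (𝓡 n) (𝓡 n) (φ ∘ ψ) x =
      (mfderiv (𝓡 n) (𝓡 n) φ (ψ x)).comp (mfderiv (𝓡 n) (𝓡 n) ψ x) := fun x =>
    mfderiv_comp x ((h'.contMDiff _).mdifferentiableAt (by simp))
      ((h.contMDiff _).mdifferentiableAt (by simp))
  refine ⟨h'.contMDiff.comp h.contMDiff, h'.isEmbedding.comp h.isEmbedding, ?_, ?_, ?_, ?_⟩
  · rw [← h.isometric, ← h'.isometric]
    funext x; ext v w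
    simp only [Tensor2.pullback, key]
    rfl
  · intro ν hν
    have : TopForm.pullback (φ ∘ ψ) ν = TopForm.pullback ψ (TopForm.pullback φ ν) := by
      funext x; ext v
      simp only [TopForm.pullback, key]
      rfl
    rw [this]
    exact h.orientation _ (h'.orientation _ hν)
  · intro τ hτ
    have : OneForm.pullback (φ ∘ ψ) τ = OneForm.pullback ψ (OneForm.pullback φ τ) := by
      funext x; ext v
      simp only [OneForm.pullback, key]
      rfl
    rw [this]
    exact h.timeOrientation _ (h'.timeOrientation _ hτ)
  · rintro γ a b hγ ⟨x, hx⟩ ⟨y, hy⟩ t ht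
    have hr := h'.causallyConvex γ a b hγ ⟨ψ x, hx⟩ ⟨ψ y, hy⟩
    obtain ⟨δ, hδ, e⟩ := h'.exists_lift hγ hr
    have hab := hδ.1.le
    have ha : δ a = ψ x := h'.isEmbedding.injective ((e a (left_mem_Icc.2 hab)).trans hx.symm)
    have hb : δ b = ψ y := h'.isEmbedding.injective ((e b (right_mem_Icc.2 hab)).trans hy.symm)
    obtain ⟨z, hz⟩ := h.causallyConvex δ a b hδ ⟨x, ha.symm⟩ ⟨y, hb.symm⟩ t ht
    exact ⟨z, by rw [← e t ht, ← hz]; rfl⟩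

end IsLocMorphism

/-! ### Concatenation of causal curves and causal diamonds -/

lemma IsSegment.shift {C : ∀ x : M, Set (TangentSpace (𝓡 n) x)} {γ : ℝ → M} {a b : ℝ}
    (h : IsSegment C γ a b) (c : ℝ) : IsSegment C (fun t => γ (t + c)) (a - c) (b - c) := by
  have hmaps : ∀ t ∈ Icc (a - c) (b - c), t + c ∈ Icc a b := fun t ht =>
    ⟨by linarith [ht.1], by linarith [ht.2]⟩
  have hab : a - c < b - c := by linarith [h.1]
  have hs : ContMDiff 𝓘(ℝ, ℝ) 𝓘(ℝ, ℝ) ∞ (fun t : ℝ => t + c) := by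
    rw [contMDiff_iff_contDiff]; fun_prop
  refine ⟨hab, h.2.1.comp hs.contMDiffOn hmaps, fun t ht => ?_⟩
  have hd : HasMFDerivWithinAt 𝓘(ℝ, ℝ) 𝓘(ℝ, ℝ) (fun t : ℝ => t + c) (Icc (a - c) (b - c)) t
      (ContinuousLinearMap.id ℝ ℝ) := by
    have : HasFDerivWithinAt (fun t : ℝ => t + c) (ContinuousLinearMap.id ℝ ℝ)
        (Icc (a - c) (b - c)) t := (hasFDerivWithinAt_id t _).add_const c
    exact this.hasMFDerivWithinAt
  have h1 : HasMFDerivWithinAt 𝓘(ℝ, ℝ) (𝓡 n) γ (Icc a b) (t + c)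
      (mfderivWithin 𝓘(ℝ, ℝ) (𝓡 n) γ (Icc a b) (t + c)) :=
    ((h.2.1 _ (hmaps t ht)).mdifferentiableWithinAt (by simp)).hasMFDerivWithinAt
  have h2 := (HasMFDerivWithinAt.comp t (u := Icc a b) (g := γ) h1 hd (fun t ht => hmaps t ht)).mfderivWithin
    (uniqueMDiffWithinAt_Icc hab ht)
  change mfderivWithin 𝓘(ℝ, ℝ) (𝓡 n) (γ ∘ fun t => t + c) _ t (1 : ℝ) ∈ _
  rw [h2]
  exact h.2.2 _ (hmaps t ht)

lemma LorentzStructure.IsCausalCurve.concat {S : LorentzStructure n M} {γ₁ γ₂ : ℝ → M}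
    {a b c d : ℝ} (h₁ : S.IsCausalCurve γ₁ a b) (h₂ : S.IsCausalCurve γ₂ c d)
    (e : γ₁ b = γ₂ c) :
    ∃ γ b', S.IsCausalCurve γ a b' ∧ γ a = γ₁ a ∧ γ b = γ₁ b ∧ γ b' = γ₂ d ∧ b ∈ Icc a b' := by
  have hab := h₁.1
  have hcd := h₂.1
  set γ : ℝ → M := fun t => if t ≤ b then γ₁ t else γ₂ (t + (c - b)) with hγ
  have e1 : ∀ t ≤ b, γ₁ t = γ t := fun t ht => by simp [hγ, ht]
  have e2 : ∀ t, b ≤ t → γ₂ (t + (c - b)) = γ t := by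
    intro t ht
    rcases ht.eq_or_lt with rfl | ht
    · simp [hγ, e]
    · simp [hγ, not_le.2 ht]
  refine ⟨γ, b + (d - c), ⟨by linarith, ?_⟩, (e1 a hab.le).symm, (e1 b le_rfl).symm, ?_,
    hab.le, by linarith⟩
  · intro t ht
    constructor
    · intro hs
      rcases lt_or_ge t b with htb | htb
      · obtain ⟨s, h3, h4⟩ := (h₁.2 t ⟨ht.1, htb.le⟩).1 ⟨b, ⟨hab.le, le_rfl⟩, htb⟩
        refine ⟨s, h3.trans (Icc_subset_Icc le_rfl (by linarith)), h4.congr fun r hr => ?_⟩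
        exact e1 r (h3 hr).2
      · obtain ⟨r, hr, htr⟩ := hs
        obtain ⟨s, h3, h4⟩ := (h₂.2 (t + (c - b)) ⟨by linarith, by linarith [ht.2]⟩).1
          ⟨d, ⟨hcd.le, le_rfl⟩, by linarith [hr.2]⟩
        have h5 := h4.shift (c - b)
        rw [add_sub_cancel_right] at h5
        have h6 := (h3 (right_mem_Icc.2 h4.1.le)).2
        refine ⟨s - (c - b), Icc_subset_Icc ht.1 (by linarith), h5.congr fun r hr => ?_⟩
        exact e2 r (htb.trans hr.1)
    · intro hs
      rcases le_or_gt t b with htb | htb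
      · obtain ⟨r, hr, htr⟩ := hs
        obtain ⟨s, h3, h4⟩ := (h₁.2 t ⟨ht.1, htb⟩).2 ⟨a, ⟨le_rfl, hab.le⟩, by linarith [hr.1]⟩
        refine ⟨s, h3.trans (Icc_subset_Icc le_rfl (by linarith)), h4.congr fun r hr => ?_⟩
        exact e1 r (h3 hr).2
      · obtain ⟨s, h3, h4⟩ := (h₂.2 (t + (c - b)) ⟨by linarith, by linarith [ht.2]⟩).2
          ⟨c, ⟨le_rfl, hcd.le⟩, by linarith⟩
        have h5 := h4.shift (c - b)
        rw [add_sub_cancel_right] at h5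
        have h6 := (h3 (left_mem_Icc.2 h4.1.le)).1
        refine ⟨s - (c - b), Icc_subset_Icc (by linarith) ht.2, h5.congr fun r hr => ?_⟩
        exact e2 r (by linarith [hr.1])
  · rw [← e2 _ (by linarith)]; congr 1; ring

namespace IsLocMorphism

variable {S : LorentzStructure n M} {S' : LorentzStructure n N} {ψ : M → N}

lemma mem_JPlus_iff (h : IsLocMorphism S S' ψ) {x y : M} :
    ψ y ∈ S'.JPlus (ψ x) ↔ y ∈ S.JPlus x := by
  constructor
  · rintro (e | ⟨γ, a, b, hγ, ha, hb⟩)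
    · exact Or.inl (h.isEmbedding.injective e)
    · obtain ⟨δ, hδ, e⟩ := h.exists_lift hγ
        (h.causallyConvex γ a b hγ ⟨x, ha.symm⟩ ⟨y, hb.symm⟩)
      refine Or.inr ⟨δ, a, b, hδ, h.isEmbedding.injective ?_, h.isEmbedding.injective ?_⟩
      · rw [e a (left_mem_Icc.2 hδ.1.le), ha]
      · rw [e b (right_mem_Icc.2 hδ.1.le), hb]
  · rintro (rfl | ⟨δ, a, b, hδ, rfl, rfl⟩)
    · exact Or.inl rfl
    · exact Or.inr ⟨ψ ∘ δ, a, b, h.isCausalCurve_comp_iff.2 hδ, rfl, rfl⟩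

/-- Global hyperbolicity is inherited by causally convex subsets. -/
lemma globallyHyperbolic (h : IsLocMorphism S S' ψ) (hS : S'.GloballyHyperbolic) :
    S.GloballyHyperbolic := by
  refine ⟨fun γ a b hγ e => ?_, fun p q => ?_⟩
  · exact hS.1 _ a b (h.isCausalCurve_comp_iff.2 hγ) (congrArg ψ e)
  · have e : S.JPlus p ∩ S.JMinus q = ψ ⁻¹' (S'.JPlus (ψ p) ∩ S'.JMinus (ψ q)) := by
      ext r
      simp only [LorentzStructure.JMinus, mem_inter_iff, mem_preimage, mem_ofPred_eq,
        h.mem_JPlus_iff]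
    rw [e, h.isEmbedding.isInducing.isCompact_preimage_iff]
    · exact hS.2 _ _
    · rintro r ⟨h1, h2⟩
      rcases h1 with rfl | ⟨γ₁, a, b, hγ₁, ha, rfl⟩
      · exact mem_range_self p
      rcases h2 with h2 | ⟨γ₂, c, d, hγ₂, hc, hd⟩
      · exact ⟨q, h2⟩
      obtain ⟨γ, b', hγ, e1, e2, e3, hb⟩ := hγ₁.concat hγ₂ hc.symm
      rw [← e2]
      exact h.causallyConvex γ a b' hγ ⟨p, by rw [e1, ha]⟩ ⟨q, by rw [e3, hd]⟩ b hb

end IsLocMorphism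

/-! ### Restriction to open subsets -/

section Restriction

open TopologicalSpace (Opens)

lemma mfderiv_val_bijective (O : Opens M) (x : O) :
    Function.Bijective (mfderiv (𝓡 n) (𝓡 n) (Subtype.val : O → M) x) := by
  classical
  let r : M → O := fun y => if h : y ∈ O then ⟨y, h⟩ else x
  have hr : (fun y : O => r y) = id := by
    funext y; simp [r]
  have hrs : ContMDiffAt (𝓡 n) (𝓡 n) ∞ r (x : M) := by
    rw [← contMDiffAt_subtype_iff, hr]
    exact contMDiffAt_id
  have hι : ContMDiff (𝓡 n) (𝓡 n) ∞ (Subtype.val : O → M) := contMDiff_subtype_val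
  have h1 := mfderiv_comp x (g := r) (f := (Subtype.val : O → M))
    (hrs.mdifferentiableAt (by simp)) ((hι x).mdifferentiableAt (by simp))
  have h2 : r ∘ (Subtype.val : O → M) = id := hr
  rw [h2, mfderiv_id] at h1
  obtain ⟨A, hA⟩ : ∃ A : EuclideanSpace ℝ (Fin n) →L[ℝ] EuclideanSpace ℝ (Fin n),
      A = mfderiv (𝓡 n) (𝓡 n) (Subtype.val : O → M) x := ⟨_, rfl⟩
  obtain ⟨B, hB⟩ : ∃ B : EuclideanSpace ℝ (Fin n) →L[ℝ] EuclideanSpace ℝ (Fin n),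
      B = mfderiv (𝓡 n) (𝓡 n) r x := ⟨_, rfl⟩
  have hBA : B.comp A = ContinuousLinearMap.id ℝ _ := by
    subst hA hB; exact h1.symm
  have hi : Function.Injective A := Function.LeftInverse.injective (g := B) fun v =>
    DFunLike.congr_fun hBA v
  have hb : Function.Bijective A :=
    ⟨hi, (LinearMap.injective_iff_surjective (f := A.toLinearMap)).1 hi⟩
  subst hA
  exact hb

lemma SmoothTensor.restrict {k : ℕ} {T : ∀ x : M, (Fin k → TangentSpace (𝓡 n) x) → ℝ}
    (hT : SmoothTensor T) (O : Opens M) :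
    SmoothTensor (fun (x : O) (w : Fin k → TangentSpace (𝓡 n) x) =>
      T x (fun i => mfderiv (𝓡 n) (𝓡 n) (Subtype.val : O → M) x (w i))) := by
  classical
  intro U hU X hX
  have hι : ContMDiff (𝓡 n) (𝓡 n) ∞ (Subtype.val : O → M) := contMDiff_subtype_val
  let Y : Fin k → ∀ y : M, TangentSpace (𝓡 n) y := fun i y =>
    if h : y ∈ O then mfderiv (𝓡 n) (𝓡 n) (Subtype.val : O → M) ⟨y, h⟩ (X i ⟨y, h⟩) else 0
  have hYX : ∀ i (x : O), Y i x = mfderiv (𝓡 n) (𝓡 n) (Subtype.val : O → M) x (X i x) := by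
    intro i x; simp [Y]
  have hV : IsOpen (Subtype.val '' U : Set M) := O.isOpen.isOpenMap_subtype_val U hU
  have hY : ∀ i, ContMDiffOn (𝓡 n) (𝓡 n).tangent ∞
      (fun y => (⟨y, Y i y⟩ : TangentBundle (𝓡 n) M)) (Subtype.val '' U) := by
    rintro i _ ⟨x, hx, rfl⟩
    apply ContMDiffAt.contMDiffWithinAt
    rw [← contMDiffAt_subtype_iff]
    have h1 : ContMDiffAt (𝓡 n) (𝓡 n).tangent ∞
        (fun x => (⟨x, X i x⟩ : TangentBundle (𝓡 n) O)) x := (hX i).contMDiffAt (hU.mem_nhds hx)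
    have h2 : ContMDiff (𝓡 n).tangent (𝓡 n).tangent ∞
        (tangentMap (𝓡 n) (𝓡 n) (Subtype.val : O → M)) :=
      hι.contMDiff_tangentMap (by simp)
    have h3 := (h2.contMDiffAt (x := (⟨x, X i x⟩ : TangentBundle (𝓡 n) O))).comp x h1
    refine h3.congr_of_eventuallyEq (Eventually.of_forall fun z => ?_)
    simp only [Function.comp, tangentMap, hYX]
  have h := (hT _ hV Y hY).comp hι.contMDiffOn (fun x hx => mem_image_of_mem _ hx)
  refine h.congr fun x hx => ?_
  simp only [Function.comp, hYX]

lemma isLorentzMetric_restrict {g : Tensor2 n M} (hg : IsLorentzMetric g) (O : Opens M) :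
    IsLorentzMetric (g.pullback (Subtype.val : O → M)) where
  smooth := SmoothTensor.restrict hg.smooth O
  symm x v w := hg.symm _ _ _
  signature x := by
    obtain ⟨T, hT, h⟩ := hg.signature x
    obtain ⟨T', rfl⟩ := (mfderiv_val_bijective O x).2 T
    refine ⟨T', hT, fun w hw h0 => h _ hw fun h1 => h0 ?_⟩
    exact (mfderiv_val_bijective O x).1 (by rw [map_zero]; exact h1)

lemma timelikeForms_restrict {g : Tensor2 n M} {τ : OneForm n M} (hτ : τ ∈ timelikeForms g)
    (O : Opens M) : τ.pullback (Subtype.val : O → M) ∈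
      timelikeForms (g.pullback (Subtype.val : O → M)) := by
  refine ⟨SmoothTensor.restrict hτ.1 O, fun x => ?_⟩
  obtain ⟨T, hT, h⟩ := hτ.2 x
  obtain ⟨T', rfl⟩ := (mfderiv_val_bijective O x).2 T
  exact ⟨T', hT, fun v => h _⟩

lemma volumeForms_restrict {ν : TopForm n M} (hν : ν ∈ volumeForms n M) (O : Opens M) :
    ν.pullback (Subtype.val : O → M) ∈ volumeForms n O := by
  refine ⟨SmoothTensor.restrict hν.1 O, fun x h => hν.2 x ?_⟩
  ext e
  choose e' he' using fun i => (mfderiv_val_bijective O x).2 (e i)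
  have : ν.pullback (Subtype.val : O → M) x e' = ν x e := by
    change ν x (fun i => mfderiv (𝓡 n) (𝓡 n) (Subtype.val : O → M) x (e' i)) = ν x e
    simp only [he']
  rw [← this, h]; rfl

/-- The induced structure on an open subset: the metric is restricted, and the orientation and
time-orientation are the components containing the restrictions of the given forms. -/
noncomputable def LorentzStructure.restrict (S : LorentzStructure n M) (O : Opens M) :
    LorentzStructure n O where
  metric := S.metric.pullback Subtype.val
  orientation := {ν ∈ volumeForms n O | ∃ ν' ∈ S.orientation,
    ∀ x (e : Fin n → TangentSpace (𝓡 n) x), 0 < ν'.pullback Subtype.val x e ↔ 0 < ν x e}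
  timeOrientation := {τ ∈ timelikeForms (S.metric.pullback Subtype.val) |
    ∃ τ' ∈ S.timeOrientation, ∀ x v, IsCausalVector (S.metric.pullback Subtype.val) x v →
      (0 < τ'.pullback Subtype.val x v ↔ 0 < τ x v)}
  isLorentzMetric := isLorentzMetric_restrict S.isLorentzMetric O
  isOrientation := by
    obtain ⟨ν₀, h, h₀⟩ := S.isOrientation
    refine ⟨ν₀.pullback Subtype.val, volumeForms_restrict h O, ?_⟩
    ext ν
    refine and_congr_right fun hν => ⟨?_, fun h1 => ⟨ν₀, ?_, h1⟩⟩
    · rintro ⟨ν', hν', h1⟩ x e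
      rw [h₀] at hν'
      exact (hν'.2 _ _).trans (h1 x e)
    · rw [h₀]; exact ⟨h, fun _ _ => Iff.rfl⟩
  isTimeOrientation := by
    obtain ⟨τ₀, h, h₀⟩ := S.isTimeOrientation
    refine ⟨τ₀.pullback Subtype.val, timelikeForms_restrict h O, ?_⟩
    ext τ
    refine and_congr_right fun hτ => ⟨?_, fun h1 => ⟨τ₀, ?_, h1⟩⟩
    · rintro ⟨τ', hτ', h1⟩ x v hv
      rw [h₀] at hτ'
      refine Iff.trans (hτ'.2 _ _ ⟨fun h2 => hv.1 ?_, hv.2⟩) (h1 x v hv)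
      exact (mfderiv_val_bijective O x).1 (by rw [map_zero]; exact h2)
    · rw [h₀]; exact ⟨h, fun _ _ _ => Iff.rfl⟩

lemma isLocMorphism_val (S : LorentzStructure n M) (O : Opens M)
    (hO : S.CausallyConvex (O : Set M)) :
    IsLocMorphism (S.restrict O) S (Subtype.val : O → M) where
  contMDiff := contMDiff_subtype_val
  isEmbedding := .subtypeVal
  isometric := rfl
  orientation ν hν := by
    refine ⟨volumeForms_restrict ?_ O, ν, hν, fun _ _ => Iff.rfl⟩
    obtain ⟨ν₀, -, h₀⟩ := S.isOrientation
    rw [h₀] at hν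
    exact hν.1
  timeOrientation τ hτ := by
    refine ⟨timelikeForms_restrict ?_ O, τ, hτ, fun _ _ _ => Iff.rfl⟩
    obtain ⟨τ₀, -, h₀⟩ := S.isTimeOrientation
    rw [h₀] at hτ
    exact hτ.1
  causallyConvex := by
    rw [Subtype.range_coe_subtype]; exact hO

end Restriction

end Geometry

/-! ### The category of globally hyperbolic spacetimes -/

/-- A globally hyperbolic spacetime of dimension `n`: a nonempty oriented and time-oriented smooth
Lorentzian manifold (Hausdorff, second countable) with finitely many connected components. -/
structure Loc (n : ℕ) : Type (u + 1) where
  carrier : Type u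
  [topologicalSpace : TopologicalSpace carrier]
  [chartedSpace : ChartedSpace (EuclideanSpace ℝ (Fin n)) carrier]
  [isManifold : IsManifold (𝓡 n) ∞ carrier]
  [t2Space : T2Space carrier]
  [secondCountable : SecondCountableTopology carrier]
  [nonempty : Nonempty carrier]
  [finiteComponents : Finite (ConnectedComponents carrier)]
  str : LorentzStructure n carrier
  globallyHyperbolic : str.GloballyHyperbolic

attribute [instance] Loc.topologicalSpace Loc.chartedSpace Loc.isManifold Loc.t2Space
  Loc.secondCountable Loc.nonempty Loc.finiteComponents

namespace Loc

variable {n : ℕ}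

/-- Morphisms of spacetimes. -/
structure Hom (M N : Loc.{u} n) : Type u where
  toFun : M.carrier → N.carrier
  isLocMorphism : IsLocMorphism M.str N.str toFun

instance : Category (Loc.{u} n) where
  Hom M N := Hom M N
  id M := ⟨_root_.id, .id⟩
  comp f g := ⟨g.toFun ∘ f.toFun, g.isLocMorphism.comp f.isLocMorphism⟩

/-- The underlying map of a morphism of spacetimes. -/
def map {M N : Loc.{u} n} (ψ : M ⟶ N) : M.carrier → N.carrier := Hom.toFun ψ

/-- A morphism is Cauchy if its image contains a Cauchy surface of the target. -/
def IsCauchy {M N : Loc.{u} n} (ψ : M ⟶ N) : Prop :=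
  ∃ A ⊆ range (map ψ), N.str.IsCauchySurface A

/-- The nonempty open causally convex subsets of `M` with finitely many connected components. -/
structure Region (M : Loc.{u} n) where
  toOpens : TopologicalSpace.Opens M.carrier
  nonempty : Nonempty toOpens
  causallyConvex : M.str.CausallyConvex (toOpens : Set M.carrier)
  finiteComponents : Finite (ConnectedComponents toOpens)

/-- The region `O`, with the structures induced from `M`, as a spacetime in its own right. -/
noncomputable def restrict (M : Loc.{u} n) (O : Region M) : Loc.{u} n :=
  have := O.nonempty
  have := O.finiteComponents
  { carrier := O.toOpens
    str := M.str.restrict O.toOpens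
    globallyHyperbolic :=
      (isLocMorphism_val M.str O.toOpens O.causallyConvex).globallyHyperbolic
        M.globallyHyperbolic }

/-- The morphism given by the inclusion of a region. -/
noncomputable def incl (M : Loc.{u} n) (O : Region M) : M.restrict O ⟶ M :=
  Hom.mk (M := M.restrict O) (N := M) Subtype.val
    (isLocMorphism_val M.str O.toOpens O.causallyConvex)

/-! ### Metric perturbations -/

/-- The support of a rank-2 tensor field. -/
def tensorSupport {M : Loc.{u} n} (h : Tensor2 n M.carrier) : Set M.carrier :=
  closure {x | h x ≠ 0}

/-- The metric perturbations `h ∈ H(M)`: smooth compactly supported rank-2 covariant tensor fields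
for which `g + h` is, with the orientation of `M` and the (unique) time-orientation `𝔱[h]` that
agrees with the one of `M` outside the support of `h`, a globally hyperbolic metric.
Time-orientations agree at a point if their members are positive on the same causal vectors. -/
structure Perturbation (M : Loc.{u} n) where
  tensor : Tensor2 n M.carrier
  smooth : tensor.Smooth
  isCompact_support : IsCompact (tensorSupport tensor)
  isLorentzMetric : IsLorentzMetric (M.str.metric + tensor)
  timeOrientation : Set (OneForm n M.carrier)
  isTimeOrientation : IsTimeOrientation (M.str.metric + tensor) timeOrientation
  agrees : ∀ x ∉ tensorSupport tensor, ∀ τ ∈ M.str.timeOrientation, ∀ τ' ∈ timeOrientation,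
    ∀ v, IsCausalVector M.str.metric x v → (0 < τ x v ↔ 0 < τ' x v)
  globallyHyperbolic : LorentzStructure.GloballyHyperbolic
    { metric := M.str.metric + tensor
      orientation := M.str.orientation
      timeOrientation := timeOrientation
      isLorentzMetric := isLorentzMetric
      isOrientation := M.str.isOrientation
      isTimeOrientation := isTimeOrientation }

/-- The perturbed spacetime `M[h]`, with the same underlying manifold. -/
noncomputable def perturb (M : Loc.{u} n) (h : Perturbation M) : Loc.{u} n where
  carrier := M.carrier
  str :=
    { metric := M.str.metric + h.tensor
      orientation := M.str.orientation
      timeOrientation := h.timeOrientation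
      isLorentzMetric := h.isLorentzMetric
      isOrientation := M.str.isOrientation
      isTimeOrientation := h.isTimeOrientation }
  globallyHyperbolic := h.globallyHyperbolic

/-- A choice of the auxiliary Cauchy morphisms `i^± : M^± ⟶ M` and `j^± : M^± ⟶ M[h]` used in the
construction of the relative Cauchy evolution: `i^±` has image in `M ∖ J^∓(supp h)`, and `j^±` has
the same underlying map as `i^±`. -/
structure CauchyWedges (M : Loc.{u} n) (h : Perturbation M) where
  plus : Loc.{u} n
  minus : Loc.{u} n
  iPlus : plus ⟶ M
  iMinus : minus ⟶ M
  jPlus : plus ⟶ M.perturb h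
  jMinus : minus ⟶ M.perturb h
  iPlus_isCauchy : IsCauchy iPlus
  iMinus_isCauchy : IsCauchy iMinus
  jPlus_isCauchy : IsCauchy jPlus
  jMinus_isCauchy : IsCauchy jMinus
  range_iPlus : range (map iPlus) ⊆ (M.str.JMinusSet (tensorSupport h.tensor))ᶜ
  range_iMinus : range (map iMinus) ⊆ (M.str.JPlusSet (tensorSupport h.tensor))ᶜ
  jPlus_eq : ∀ x, map jPlus x = map iPlus x
  jMinus_eq : ∀ x, map jMinus x = map iMinus x

end Loc

/-! ### The category of algebras -/

/-- Nonzero unital complex `*`-algebras. -/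
structure Alg : Type (v + 1) where
  carrier : Type v
  [ring : Ring carrier]
  [algebra : Algebra ℂ carrier]
  [starRing : StarRing carrier]
  [starModule : StarModule ℂ carrier]
  [nontrivial : Nontrivial carrier]

attribute [instance] Alg.ring Alg.algebra Alg.starRing Alg.starModule Alg.nontrivial

namespace Alg

/-- Injective unital `*`-homomorphisms. -/
structure Hom (A B : Alg.{v}) : Type v where
  toStarAlgHom : A.carrier →⋆ₐ[ℂ] B.carrier
  injective : Function.Injective toStarAlgHom

instance : Category Alg.{v} where
  Hom A B := Hom A B
  id A := ⟨StarAlgHom.id ℂ A.carrier, fun _ _ h => h⟩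
  comp f g := ⟨g.toStarAlgHom.comp f.toStarAlgHom, g.injective.comp f.injective⟩

/-- The underlying `*`-homomorphism of a morphism of algebras. -/
def hom {A B : Alg.{v}} (f : A ⟶ B) : A.carrier →⋆ₐ[ℂ] B.carrier := Hom.toStarAlgHom f

end Alg

/-! ### Locally covariant theories -/

/-- A locally covariant theory is a functor from spacetimes to algebras. -/
abbrev Theory (n : ℕ) := Loc.{u} n ⥤ Alg.{v}

namespace Theory

variable {n : ℕ}

/-- The kinematic algebra of the region `O` of `M`: the image of the algebra of the spacetime `O`
under the inclusion. -/
noncomputable def kin (A : Theory.{u, v} n) (M : Loc.{u} n) (O : Loc.Region M) :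
    StarSubalgebra ℂ (A.obj M).carrier :=
  (Alg.hom (A.map (M.incl O))).range

/-- The timeslice property: Cauchy morphisms are mapped to isomorphisms. -/
def Timeslice (A : Theory.{u, v} n) : Prop :=
  ∀ ⦃M N : Loc.{u} n⦄ (ψ : M ⟶ N), Loc.IsCauchy ψ → IsIso (A.map ψ)

/-- The relative Cauchy evolution
`rce_M[h] = A(i⁻) ∘ A(j⁻)⁻¹ ∘ A(j⁺) ∘ A(i⁺)⁻¹` of a theory with the timeslice property, as an
automorphism of `A(M)`, computed with the Cauchy morphisms in `W`. -/
noncomputable def rce (A : Theory.{u, v} n) (hA : A.Timeslice) {M : Loc.{u} n}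
    {h : Loc.Perturbation M} (W : Loc.CauchyWedges M h) : Aut (A.obj M) :=
  have := hA W.iPlus W.iPlus_isCauchy
  have := hA W.jPlus W.jPlus_isCauchy
  have := hA W.iMinus W.iMinus_isCauchy
  have := hA W.jMinus W.jMinus_isCauchy
  (asIso (A.map W.iPlus)).symm ≪≫ asIso (A.map W.jPlus) ≪≫
    (asIso (A.map W.jMinus)).symm ≪≫ asIso (A.map W.iMinus)

end Theory

end LocCov

namespace LocCov

/-! ### Composition in the category of algebras -/

namespace Alg

/-! Everything here is a consequence of naturality. Kinematic algebras, the action of endomorphisms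
and the relative Cauchy evolution are all built by applying the functor to morphisms of spacetimes
and then taking images, composites and inverses, and each of these operations is compatible with a
natural transformation.

For kinematic algebras, the square of the inclusion `M.incl O` shows that the image of `A(M|_O)` in
`A(M)` is carried by `η` into the image of `B(M|_O)` in `B(M)` (`map_kin_le`). If `η` is invertible,
the same inclusion for its inverse gives equality (`map_kin_eq`). For an endomorphism the claim is
the naturality square itself (`hom_app_comp_hom_map`).

For the relative Cauchy evolution, a naturality square whose two horizontal arrows are invertible
remains commutative when both are replaced by their inverses; the timeslice property supplies this
invertibility for Cauchy morphisms, and `η` itself need not be invertible. Pasting the squares of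
`i⁺`, `j⁺`, `j⁻`, `i⁻`, with those of `i⁺` and `j⁻` inverted, gives the intertwining relation
(`rce_hom_comp_app`). The pasting uses one choice of wedges for both theories, so independence of
that choice plays no role. -/

lemma hom_comp {A B C : Alg.{v}} (f : A ⟶ B) (g : B ⟶ C) :
    hom (f ≫ g) = (hom g).comp (hom f) := rfl

end Alg

/-! ### Consequences of naturality for kinematic algebras and relative Cauchy evolution -/

namespace Theory

variable {n : ℕ} {A B : Theory.{u, v} n}

/-- Naturality in a form that can be evaluated on elements of the algebras. Taking `ψ` to be the
inclusion of a region controls kinematic algebras; taking `N = M` gives the statement on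
endomorphisms. -/
lemma hom_app_comp_hom_map (η : A ⟶ B) {M N : Loc.{u} n} (ψ : M ⟶ N) :
    (Alg.hom (η.app N)).comp (Alg.hom (A.map ψ)) =
      (Alg.hom (B.map ψ)).comp (Alg.hom (η.app M)) := by
  rw [← Alg.hom_comp, ← Alg.hom_comp, η.naturality]

/-- A subtheory embedding maps kinematic algebras into kinematic algebras. -/
lemma map_kin_le (η : A ⟶ B) (M : Loc.{u} n) (O : Loc.Region M) :
    (A.kin M O).map (Alg.hom (η.app M)) ≤ B.kin M O := by
  rintro _ ⟨_, ⟨a, rfl⟩, rfl⟩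
  -- The preimage in `B(M|_O)` comes from applying `η` already at the region: `η_M (A(ι) a) = B(ι)
  -- (η_{M|O} a)`.
  exact ⟨Alg.hom (η.app (M.restrict O)) a,
    (DFunLike.congr_fun (hom_app_comp_hom_map η (M.incl O)) a).symm⟩

/-- An equivalence of theories identifies their kinematic algebras. -/
lemma map_kin_eq (η : A ⟶ B) [IsIso η] (M : Loc.{u} n) (O : Loc.Region M) :
    (A.kin M O).map (Alg.hom (η.app M)) = B.kin M O := by
  refine le_antisymm (map_kin_le η M O) fun b hb => ?_
  -- The inverse transformation is itself a subtheory embedding of `B` into `A`, so it sends `b`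
  -- into the kinematic algebra of `A`. It remains to see that `η_M` sends the result back to `b`.
  refine ⟨Alg.hom ((inv η).app M) b, map_kin_le (inv η) M O ⟨b, hb, rfl⟩, ?_⟩
  have h : (inv η).app M ≫ η.app M = 𝟙 (B.obj M) := by
    rw [← NatTrans.comp_app, IsIso.inv_hom_id, NatTrans.id_app]
  -- Composition of algebra morphisms and the identity morphism unfold definitionally, so evaluating
  -- `h` at `b` is the required equation.
  exact DFunLike.congr_fun (congrArg Alg.hom h) b

/-- A subtheory embedding intertwines the relative Cauchy evolutions. -/
lemma rce_hom_comp_app (η : A ⟶ B) (hA : A.Timeslice) (hB : B.Timeslice) {M : Loc.{u} n}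
    {h : Loc.Perturbation M} (W : Loc.CauchyWedges M h) :
    (A.rce hA W).hom ≫ η.app M = η.app M ≫ (B.rce hB W).hom := by
  have := hA W.iPlus W.iPlus_isCauchy
  have := hA W.jMinus W.jMinus_isCauchy
  have := hB W.iPlus W.iPlus_isCauchy
  have := hB W.jMinus W.jMinus_isCauchy
  -- The naturality square of `ψ` read backwards: multiplying it by the inverses of `A(ψ)` and
  -- `B(ψ)` on the two sides gives commutation with the inverses.
  have inv_naturality {N P : Loc.{u} n} (ψ : N ⟶ P) [IsIso (A.map ψ)] [IsIso (B.map ψ)] :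
      inv (A.map ψ) ≫ η.app N = η.app P ≫ inv (B.map ψ) := by
    rw [IsIso.inv_comp_eq, ← Category.assoc, IsIso.eq_comp_inv, η.naturality]
  -- Unfolds `rce` on both sides. In diagrammatic order the evolution starts with the inverse of
  -- `A(i⁺)`, opposite to the usual formula. The invertibility proofs introduced here agree with
  -- those inside `rce` because `IsIso` is a proposition.
  change (inv (A.map W.iPlus) ≫ A.map W.jPlus ≫ inv (A.map W.jMinus) ≫ A.map W.iMinus) ≫
      η.app M =
    η.app M ≫ inv (B.map W.iPlus) ≫ B.map W.jPlus ≫ inv (B.map W.jMinus) ≫ B.map W.iMinus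
  -- On the left, `η` moves past `A(i⁻)` and stops at the inverse of `A(j⁻)`, now at the spacetime
  -- `M⁻`.
  simp only [Category.assoc, η.naturality]
  -- On the right, `η` moves the other way, past the `B`-arrows of `i⁺`, `j⁺` and `j⁻`, turning them
  -- into `A`-arrows. The two sides meet with `η` at `M⁻`, between the inverse of `A(j⁻)` and
  -- `B(i⁻)`.
  rw [← reassoc_of% (inv_naturality W.iPlus), ← η.naturality_assoc,
    ← reassoc_of% (inv_naturality W.jMinus)]

end Theory

end LocCov

/-! ### The proposition -/

theorem mainTheorem8 (n : ℕ) (A B : LocCov.Theory.{u, v} n) (η : A ⟶ B) :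
    (∀ (M : LocCov.Loc.{u} n) (O : LocCov.Loc.Region M),
      (A.kin M O).map (LocCov.Alg.hom (η.app M)) ≤ B.kin M O ∧
      (IsIso η → (A.kin M O).map (LocCov.Alg.hom (η.app M)) = B.kin M O)) ∧
    (∀ (M : LocCov.Loc.{u} n) (ψ : M ⟶ M),
      (LocCov.Alg.hom (η.app M)).comp (LocCov.Alg.hom (A.map ψ)) =
        (LocCov.Alg.hom (B.map ψ)).comp (LocCov.Alg.hom (η.app M))) ∧
    (∀ (hA : A.Timeslice) (hB : B.Timeslice) (M : LocCov.Loc.{u} n)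
      (h : LocCov.Loc.Perturbation M) (W : LocCov.Loc.CauchyWedges M h),
      (LocCov.Alg.hom (η.app M)).comp (LocCov.Alg.hom (A.rce hA W).hom) =
        (LocCov.Alg.hom (B.rce hB W).hom).comp (LocCov.Alg.hom (η.app M))) := by
  refine ⟨fun M O => ⟨LocCov.Theory.map_kin_le η M O, fun _ => LocCov.Theory.map_kin_eq η M O⟩,
    fun M ψ => LocCov.Theory.hom_app_comp_hom_map η ψ, fun hA hB M h W => ?_⟩
  -- Each composite of `*`-homomorphisms is recognised as the underlying map of a composite in
  -- `Alg`, with the order reversed, so that the categorical identity applies.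
  rw [← LocCov.Alg.hom_comp, ← LocCov.Alg.hom_comp, LocCov.Theory.rce_hom_comp_app]
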